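/- For integers $m,n\ge 6$ let $T_{m,n}$ be the torus with $m$ rows and $n$ columns. Let $$t_{LT}(m,n)=\lfloor n/2\rfloor+\lfloor m/2\rfloor-2 .$$ Let $t_{UT}(m,n)$ be the capture time computed for the three-cop algorithm TGRID on $T_{m,n}$: put $t_{UT}(m,n)=t_{UT}(n,m)$ if $m>n$, and for $m\le n$ $$t_{UT}(m,n)=t_1+t_2+t_3+1,\qquad t_1=\lceil 2n/3\rceil-\lceil n/2\rceil ,$$ where $t_1,t_2,t_3$ are the numbers of rounds used to establish the guard, to build a pre-siege and to build a siege, namely - if $m\le\lceil n/2\rceil$: $t_2=\lceil n/2\rceil+2\lfloor m/2\rfloor-3$ and $t_3=\lceil(\lceil m/2\rceil-3)/2\rceil$; - if $m>\lceil n/2\rceil$ and $\lceil n/2\rceil$ is even: $t_2=2\lceil n/2\rceil-3$ and $t_3=\lceil(m-\lceil n/4\rceil-3)/2\rceil$; - if $m>\lceil n/2\rceil$ and $\lceil n/2\rceil$ is odd: $t_2=2\lceil n/2\rceil-4$ and $t_3=\lceil(m-\lfloor n/4\rfloor-3)/2\rceil$. Then $$\frac{t_{UT}(m,n)}{t_{LT}(m,n)}\to\frac43\quad\text{as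 } n/m\to\infty,\qquad \frac{t_{UT}(m,n)}{t_{LT}(m,n)}\to\frac{37}{24}\quad\text{as } n/m\to1 \text{ and } n\to\infty .$$ Both limits hold as well when $t_{UT}(m,n)$ is replaced by any real numbers $t(m,n)$ such that, with $a=\min(m,n)$ and $b=\max(m,n)$, $$\tfrac{2b}{3}+\tfrac{5a}{4}-\tfrac92\le t(m,n)\le\tfrac{2b}{3}+\tfrac{5a}{4}-\tfrac{25}{12}\quad\text{if } a\le\lceil b/2\rceil,$$ $$\tfrac{25b}{24}+\tfrac a2-\tfrac92\le t(m,n)\le\tfrac{25b}{24}+\tfrac a2-\tfrac{17}{8}\quad\text{if } a>\lceil b/2\rceil .$$ -/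

import Mathlib

namespace TorusChase

/-! Round counts of the three-cop capture algorithm TGRID on the torus with `m` rows and `n`
columns, `6 ≤ m ≤ n`, in the longest chase considered in its analysis, and the lower bound it is
compared with. -/

/-- Guard phase: the cop that will chase goes from column `⌈2n/3⌉` to column `⌈n/2⌉`. -/
def guardRounds (n : ℕ) : ℤ := ⌈(2 * n : ℚ) / 3⌉ - ⌈(n : ℚ) / 2⌉

/-- The row in which the robber waits until a pre-siege is built around it (the cops start in
row `0`). -/
def waitingRow (m n : ℕ) : ℤ :=
  if (m : ℤ) ≤ ⌈(n : ℚ) / 2⌉ then ⌊(m : ℚ) / 2⌋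
  else if Even ⌈(n : ℚ) / 2⌉ then ⌈(n : ℚ) / 4⌉
  else ⌊(n : ℚ) / 4⌋

/-- Rounds before the pre-siege in which one of the two chasing cops moves horizontally. -/
def horizontalRounds (n : ℕ) : ℤ := ⌈(n : ℚ) / 2⌉ - 2

/-- Rounds before the pre-siege in which one of the two chasing cops moves down. -/
def verticalRounds (m n : ℕ) : ℤ :=
  if (m : ℤ) ≤ ⌈(n : ℚ) / 2⌉ then 2 * ⌊(m : ℚ) / 2⌋ - 1
  else if Even ⌈(n : ℚ) / 2⌉ then ⌈(n : ℚ) / 2⌉ - 1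
  else ⌈(n : ℚ) / 2⌉ - 2

/-- Number of cop-free rows between the robber, which has just stepped down from its waiting row,
and the guard in row `m - 1`. -/
def freeRows (m n : ℕ) : ℤ := (m - 1) - (waitingRow m n + 1) - 1

/-- Rounds from the pre-siege to the siege: the free rows shrink by two in every round. -/
def siegeRounds (m n : ℕ) : ℤ := ⌈(freeRows m n : ℚ) / 2⌉

/-- Total for `m ≤ n`: guard, pre-siege, siege, and one round for the capture itself. -/
def tgridRounds (m n : ℕ) : ℤ :=
  guardRounds n + (horizontalRounds n + verticalRounds m n) + siegeRounds m n + 1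

/-- The capture time `t_UT` of TGRID on the `m × n` torus; rows and columns are exchanged
if `n < m`. -/
def tUT (m n : ℕ) : ℤ := tgridRounds (min m n) (max m n)

/-- The lower bound `t_LT`. -/
def tLT (m n : ℕ) : ℤ := ⌊(n : ℚ) / 2⌋ + ⌊(m : ℚ) / 2⌋ - 2

/-- The two-sided estimate of the capture time of TGRID for `m ≤ n`. -/
def EstimateOrdered (m n : ℕ) (t : ℝ) : Prop :=
  ((m : ℤ) ≤ ⌈(n : ℚ) / 2⌉ →
    2 * (n : ℝ) / 3 + 5 * (m : ℝ) / 4 - 9 / 2 ≤ t ∧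
    t ≤ 2 * (n : ℝ) / 3 + 5 * (m : ℝ) / 4 - 25 / 12) ∧
  (⌈(n : ℚ) / 2⌉ < (m : ℤ) →
    25 * (n : ℝ) / 24 + (m : ℝ) / 2 - 9 / 2 ≤ t ∧
    t ≤ 25 * (n : ℝ) / 24 + (m : ℝ) / 2 - 17 / 8)

/-- The two-sided estimate on the `m × n` torus; rows and columns are exchanged if `n < m`. -/
def Estimate (m n : ℕ) (t : ℝ) : Prop := EstimateOrdered (min m n) (max m n) t

end TorusChase

namespace TorusChase

/-! Limits of quotients see only linear growth. Rounding and parity change the round counts by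
bounded amounts, so `tUT` and every `t` obeying the two-sided estimate satisfy one `LooseEstimate`,
while `tLT` is `(m + n) / 2` up to a constant. After division by the number of columns the errors
vanish (`tendsto_div_of_abs_sub_le`). For `n / m → ∞` this gives `(2/3) / (1/2) = 4/3`; for `n / m →
1` it gives `(25/24 + 1/2) / (1/2 + 1/2) = 37/24`. -/

/-- A two-sided estimate with slack `10` on both sides, common to `tgridRounds` and
`EstimateOrdered`. -/
def LooseEstimate (a b : ℕ) (t : ℝ) : Prop :=
  ((a : ℤ) ≤ ⌈(b : ℚ) / 2⌉ → |t - (2 * (b : ℝ) / 3 + 5 * (a : ℝ) / 4)| ≤ 10) ∧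
  (⌈(b : ℚ) / 2⌉ < (a : ℤ) → |t - (25 * (b : ℝ) / 24 + (a : ℝ) / 2)| ≤ 10)

theorem EstimateOrdered.looseEstimate {a b : ℕ} {t : ℝ} (h : EstimateOrdered a b t) :
    LooseEstimate a b t := by
  refine ⟨fun hab => ?_, fun hab => ?_⟩
  · obtain ⟨h1, h2⟩ := h.1 hab
    rw [abs_le]
    constructor <;> linarith
  · obtain ⟨h1, h2⟩ := h.2 hab
    rw [abs_le]
    constructor <;> linarith

/-- `⌈b/2⌉` cancels between the guard and horizontal rounds, leaving about `2b/3`. The vertical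
rounds add about `a` and the siege `a/4`, whence `5a/4`. -/
theorem abs_tgridRounds_sub_le_of_le {a b : ℕ} (h : (a : ℤ) ≤ ⌈(b : ℚ) / 2⌉) :
    |(tgridRounds a b : ℚ) - (2 * (b : ℚ) / 3 + 5 * (a : ℚ) / 4)| ≤ 10 := by
  simp only [tgridRounds, guardRounds, horizontalRounds, verticalRounds, siegeRounds, if_pos h]
  have hf : freeRows a b = a - 3 - ⌊(a : ℚ) / 2⌋ := by
    simp only [freeRows, waitingRow, if_pos h]
    ring
  have h1 := Int.le_ceil ((2 * b : ℚ) / 3)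
  have h2 := Int.ceil_lt_add_one ((2 * b : ℚ) / 3)
  have h3 := Int.floor_le ((a : ℚ) / 2)
  have h4 := Int.lt_floor_add_one ((a : ℚ) / 2)
  have h5 := Int.le_ceil ((freeRows a b : ℚ) / 2)
  have h6 := Int.ceil_lt_add_one ((freeRows a b : ℚ) / 2)
  have hf' : (freeRows a b : ℚ) = a - 3 - ⌊(a : ℚ) / 2⌋ := by
    rw [hf]
    push_cast
    ring
  push_cast
  rw [abs_le]
  constructor <;> linarith

theorem abs_waitingRow_sub_le_of_lt {a b : ℕ} (h : ⌈(b : ℚ) / 2⌉ < (a : ℤ)) :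
    |(waitingRow a b : ℚ) - (b : ℚ) / 4| ≤ 1 := by
  have h1 := Int.le_ceil ((b : ℚ) / 4)
  have h2 := Int.ceil_lt_add_one ((b : ℚ) / 4)
  have h3 := Int.floor_le ((b : ℚ) / 4)
  have h4 := Int.lt_floor_add_one ((b : ℚ) / 4)
  simp only [waitingRow, if_neg h.not_ge]
  rw [abs_le]
  split_ifs <;> constructor <;> linarith

theorem abs_verticalRounds_sub_le_of_lt {a b : ℕ} (h : ⌈(b : ℚ) / 2⌉ < (a : ℤ)) :
    |(verticalRounds a b : ℚ) - (b : ℚ) / 2| ≤ 2 := by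
  have h1 := Int.le_ceil ((b : ℚ) / 2)
  have h2 := Int.ceil_lt_add_one ((b : ℚ) / 2)
  simp only [verticalRounds, if_neg h.not_ge]
  rw [abs_le]
  split_ifs <;> push_cast <;> constructor <;> linarith

/-- Up to constants, guard plus horizontal rounds give `2b/3`, the vertical ones `b/2`, and the
siege `(a - b/4) / 2`; thus `25/24 = 2/3 + 1/2 - 1/8`. -/
theorem abs_tgridRounds_sub_le_of_lt {a b : ℕ} (h : ⌈(b : ℚ) / 2⌉ < (a : ℤ)) :
    |(tgridRounds a b : ℚ) - (25 * (b : ℚ) / 24 + (a : ℚ) / 2)| ≤ 10 := by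
  obtain ⟨h1, h2⟩ := abs_le.1 (abs_waitingRow_sub_le_of_lt h)
  obtain ⟨h3, h4⟩ := abs_le.1 (abs_verticalRounds_sub_le_of_lt h)
  have h5 := Int.le_ceil ((freeRows a b : ℚ) / 2)
  have h6 := Int.ceil_lt_add_one ((freeRows a b : ℚ) / 2)
  have h7 := Int.le_ceil ((2 * b : ℚ) / 3)
  have h8 := Int.ceil_lt_add_one ((2 * b : ℚ) / 3)
  have hf : (freeRows a b : ℚ) = a - 3 - waitingRow a b := by
    simp only [freeRows]
    push_cast
    ring
  simp only [tgridRounds, guardRounds, horizontalRounds, siegeRounds]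
  push_cast
  rw [abs_le]
  constructor <;> linarith

theorem looseEstimate_tgridRounds (a b : ℕ) : LooseEstimate a b (tgridRounds a b) :=
  ⟨fun h => by simpa using (Rat.cast_le (K := ℝ)).2 (abs_tgridRounds_sub_le_of_le h),
    fun h => by simpa using (Rat.cast_le (K := ℝ)).2 (abs_tgridRounds_sub_le_of_lt h)⟩

theorem abs_tLT_sub_le (m n : ℕ) :
    |(tLT m n : ℝ) - ((n : ℝ) / 2 + (m : ℝ) / 2)| ≤ 4 := by
  have h : |(tLT m n : ℚ) - ((n : ℚ) / 2 + (m : ℚ) / 2)| ≤ 4 := by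
    have h1 := Int.floor_le ((n : ℚ) / 2)
    have h2 := Int.lt_floor_add_one ((n : ℚ) / 2)
    have h3 := Int.floor_le ((m : ℚ) / 2)
    have h4 := Int.lt_floor_add_one ((m : ℚ) / 2)
    simp only [tLT]
    push_cast
    rw [abs_le]
    constructor <;> linarith
  simpa using (Rat.cast_le (K := ℝ)).2 h

open Filter Topology

variable {ι : Type*} {l : Filter ι}

/-- If `u` differs from `α n + β m` by a bounded amount and `m / n → r`, then
`u / n → α + β r`. -/
theorem tendsto_div_of_abs_sub_le {m n u : ι → ℝ} {α β r C : ℝ}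
    (hn : Tendsto n l atTop) (hmn : Tendsto (fun i => m i / n i) l (𝓝 r))
    (hu : ∀ᶠ i in l, |u i - (α * n i + β * m i)| ≤ C) :
    Tendsto (fun i => u i / n i) l (𝓝 (α + β * r)) := by
  have h0 : Tendsto (fun i => (u i - (α * n i + β * m i)) / n i) l (𝓝 0) := by
    refine squeeze_zero_norm' ?_ (hn.const_div_atTop C)
    filter_upwards [hu, hn.eventually_gt_atTop 0] with i hi hpos
    rw [Real.norm_eq_abs, abs_div, abs_of_pos hpos]
    gcongr
  have h1 := h0.add ((hmn.const_mul β).const_add α)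
  rw [zero_add] at h1
  refine h1.congr' ?_
  filter_upwards [hn.eventually_gt_atTop 0] with i hpos
  field_simp
  ring

theorem tendsto_div_tLT {m n : ι → ℕ} {t : ι → ℝ} {r s : ℝ}
    (hn : Tendsto (fun i => (n i : ℝ)) l atTop)
    (hmn : Tendsto (fun i => (m i : ℝ) / n i) l (𝓝 r)) (hr : 0 ≤ r)
    (ht : Tendsto (fun i => t i / n i) l (𝓝 s)) :
    Tendsto (fun i => t i / (tLT (m i) (n i) : ℝ)) l (𝓝 (s / (1 / 2 + 1 / 2 * r))) := by
  have hL : Tendsto (fun i => (tLT (m i) (n i) : ℝ) / n i) l (𝓝 (1 / 2 + 1 / 2 * r)) := by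
    refine tendsto_div_of_abs_sub_le (C := 4) hn hmn (Eventually.of_forall fun i => ?_)
    convert abs_tLT_sub_le (m i) (n i) using 3
    ring
  refine (ht.div hL (by positivity)).congr' ?_
  filter_upwards [hn.eventually_gt_atTop 0] with i hpos
  exact div_div_div_cancel_right₀ hpos.ne' _ _

theorem tendsto_div_tLT_of_ratio_atTop {m n : ι → ℕ} {t : ι → ℝ} (hm : ∀ i, 1 ≤ m i)
    (h : Tendsto (fun i => (n i : ℝ) / (m i : ℝ)) l atTop)
    (ht : ∀ i, LooseEstimate (min (m i) (n i)) (max (m i) (n i)) (t i)) :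
    Tendsto (fun i => t i / (tLT (m i) (n i) : ℝ)) l (𝓝 (4 / 3)) := by
  have hn : Tendsto (fun i => (n i : ℝ)) l atTop :=
    tendsto_atTop_mono
      (fun i => div_le_self (Nat.cast_nonneg _) (by exact_mod_cast hm i)) h
  have hmn : Tendsto (fun i => (m i : ℝ) / n i) l (𝓝 0) := by
    simpa only [Function.comp_def, inv_div] using tendsto_inv_atTop_zero.comp h
  have htn : Tendsto (fun i => t i / n i) l (𝓝 (2 / 3 + 5 / 4 * 0)) := by
    refine tendsto_div_of_abs_sub_le (C := 10) hn hmn ?_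
    -- A ratio of at least `2` makes `m` the smaller side and selects the first regime.
    filter_upwards [h.eventually_ge_atTop 2] with i hi
    have hpos : (0 : ℝ) < m i := by exact_mod_cast hm i
    have h2 : 2 * m i ≤ n i := by exact_mod_cast (le_div_iff₀ hpos).1 hi
    have hi' := ht i
    rw [min_eq_left (by omega), max_eq_right (by omega)] at hi'
    have hle : (m i : ℤ) ≤ ⌈(n i : ℚ) / 2⌉ := by
      have h2' : 2 * (m i : ℚ) ≤ n i := by exact_mod_cast h2
      have := Int.le_ceil ((n i : ℚ) / 2)
      have h3 : (m i : ℚ) ≤ ⌈(n i : ℚ) / 2⌉ := by linarith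
      exact_mod_cast h3
    convert hi'.1 hle using 3
    ring
  convert tendsto_div_tLT hn hmn le_rfl htn using 2
  norm_num

/-- `⌈b/2⌉ < b/2 + 1 ≤ 3b/4 ≤ a`, the middle step needing only `b ≥ 4`. -/
theorem ceil_half_lt_of_three_mul_le {a b : ℕ} (hb : 5 ≤ b) (h : 3 * b ≤ 4 * a) :
    ⌈(b : ℚ) / 2⌉ < (a : ℤ) := by
  have hb' : (5 : ℚ) ≤ b := by exact_mod_cast hb
  have h' : 3 * (b : ℚ) ≤ 4 * a := by exact_mod_cast h
  have := Int.ceil_lt_add_one ((b : ℚ) / 2)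
  have h3 : (⌈(b : ℚ) / 2⌉ : ℚ) < a := by linarith
  exact_mod_cast h3

theorem tendsto_div_tLT_of_ratio_one {m n : ι → ℕ} {t : ι → ℝ} (hm : ∀ i, 5 ≤ m i)
    (h : Tendsto (fun i => (n i : ℝ) / (m i : ℝ)) l (𝓝 1)) (hn : Tendsto n l atTop)
    (ht : ∀ i, LooseEstimate (min (m i) (n i)) (max (m i) (n i)) (t i)) :
    Tendsto (fun i => t i / (tLT (m i) (n i) : ℝ)) l (𝓝 (37 / 24)) := by
  have hn' : Tendsto (fun i => (n i : ℝ)) l atTop := tendsto_natCast_atTop_atTop.comp hn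
  have hmn : Tendsto (fun i => (m i : ℝ) / n i) l (𝓝 1) := by
    simpa only [inv_div, inv_one] using h.inv₀ one_ne_zero
  have hmax : Tendsto (fun i => ((max (m i) (n i) : ℕ) : ℝ) / n i) l (𝓝 1) := by
    have := hmn.max (tendsto_const_nhds (x := (1 : ℝ)))
    rw [max_self] at this
    refine this.congr' ?_
    filter_upwards [hn'.eventually_gt_atTop 0] with i hpos
    rw [Nat.cast_max, ← max_div_div_right hpos.le, div_self hpos.ne']
  have hmin : Tendsto (fun i => ((min (m i) (n i) : ℕ) : ℝ) / n i) l (𝓝 1) := by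
    have := hmn.min (tendsto_const_nhds (x := (1 : ℝ)))
    rw [min_self] at this
    refine this.congr' ?_
    filter_upwards [hn'.eventually_gt_atTop 0] with i hpos
    rw [Nat.cast_min, ← min_div_div_right hpos.le, div_self hpos.ne']
  have hmaxTop : Tendsto (fun i => ((max (m i) (n i) : ℕ) : ℝ)) l atTop :=
    tendsto_atTop_mono (fun i => by exact_mod_cast le_max_right (m i) (n i)) hn'
  have hminmax : Tendsto (fun i => ((min (m i) (n i) : ℕ) : ℝ) / (max (m i) (n i) : ℕ)) l
      (𝓝 1) := by
    have := hmin.div hmax one_ne_zero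
    rw [div_one] at this
    refine this.congr' ?_
    filter_upwards [hn'.eventually_gt_atTop 0] with i hpos
    exact div_div_div_cancel_right₀ hpos.ne' _ _
  -- Which side is longer may vary with `i`, so `t` is first normalised by the maximum, in which the
  -- estimate is expressed, and then by `n`.
  have htmax : Tendsto (fun i => t i / (max (m i) (n i) : ℕ)) l (𝓝 (25 / 24 + 1 / 2 * 1)) := by
    refine tendsto_div_of_abs_sub_le (C := 10) hmaxTop hminmax ?_
    -- Any constant strictly between `1/2` and `1` would eventually force the second regime.
    filter_upwards [hminmax.eventually_const_le (u := 3 / 4) (by norm_num),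
      hmaxTop.eventually_gt_atTop 0] with i hi hpos
    have h34 : 3 * max (m i) (n i) ≤ 4 * min (m i) (n i) := by
      have := (le_div_iff₀ hpos).1 hi
      have h' : 3 * ((max (m i) (n i) : ℕ) : ℝ) ≤ 4 * ((min (m i) (n i) : ℕ) : ℝ) := by
        linarith
      exact_mod_cast h'
    convert (ht i).2 (ceil_half_lt_of_three_mul_le ((hm i).trans (le_max_left _ _)) h34) using 3
    ring
  have htn : Tendsto (fun i => t i / n i) l (𝓝 ((25 / 24 + 1 / 2 * 1) * 1)) := by
    refine (htmax.mul hmax).congr' ?_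
    filter_upwards [hmaxTop.eventually_gt_atTop 0] with i hpos
    exact div_mul_div_cancel₀ hpos.ne'
  convert tendsto_div_tLT hn' hmn zero_le_one htn using 2
  norm_num

end TorusChase

theorem mainTheorem11 {ι : Type*} (l : Filter ι) (m n : ι → ℕ)
    (hm : ∀ i, 6 ≤ m i) (hn : ∀ i, 6 ≤ n i) :
    (Filter.Tendsto (fun i => (n i : ℝ) / (m i : ℝ)) l Filter.atTop →
      Filter.Tendsto
        (fun i => (TorusChase.tUT (m i) (n i) : ℝ) / (TorusChase.tLT (m i) (n i) : ℝ))
        l (nhds (4 / 3)) ∧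
      ∀ t : ι → ℝ, (∀ i, TorusChase.Estimate (m i) (n i) (t i)) →
        Filter.Tendsto (fun i => t i / (TorusChase.tLT (m i) (n i) : ℝ)) l (nhds (4 / 3))) ∧
    (Filter.Tendsto (fun i => (n i : ℝ) / (m i : ℝ)) l (nhds 1) →
      Filter.Tendsto n l Filter.atTop →
      Filter.Tendsto
        (fun i => (TorusChase.tUT (m i) (n i) : ℝ) / (TorusChase.tLT (m i) (n i) : ℝ))
        l (nhds (37 / 24)) ∧
      ∀ t : ι → ℝ, (∀ i, TorusChase.Estimate (m i) (n i) (t i)) →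
        Filter.Tendsto (fun i => t i / (TorusChase.tLT (m i) (n i) : ℝ)) l (nhds (37 / 24))) := by
  refine ⟨fun h => ?_, fun h hn' => ?_⟩
  · have key := fun t ht => TorusChase.tendsto_div_tLT_of_ratio_atTop (t := t)
      (fun i => le_trans (by norm_num) (hm i)) h ht
    exact ⟨key _ fun i => TorusChase.looseEstimate_tgridRounds _ _,
      fun t ht => key t fun i => TorusChase.EstimateOrdered.looseEstimate (ht i)⟩
  · have key := fun t ht => TorusChase.tendsto_div_tLT_of_ratio_one (t := t)
      (fun i => le_trans (by norm_num) (hm i)) h hn' ht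
    exact ⟨key _ fun i => TorusChase.looseEstimate_tgridRounds _ _,
      fun t ht => key t fun i => TorusChase.EstimateOrdered.looseEstimate (ht i)⟩
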